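/- Let $d>0$ and $\beta>0$ be arbitrary real numbers (in the application $d=\nu\,\Delta t/(\rho c\,\Delta z^2)$ is the diffusive and $\beta=b\,\Delta t/(\rho c\,\Delta z)$ the bulk Courant number of the half-line $z<0$). Consider the backward Euler scheme for the diffusion equation on $z<0$ with the temperature of the other side fixed to $0$ and with implicit interfacial flux: for $n\ge 0$, $$T_{j+1/2}^{n+1}-T_{j+1/2}^{n}=d\,\bigl(T_{j+3/2}^{n+1}-2T_{j+1/2}^{n+1}+T_{j-1/2}^{n+1}\bigr)\quad (j\le -2),$$ $$T_{-1/2}^{n+1}-T_{-1/2}^{n}=-\beta\,T_{-1/2}^{n+1}-d\,\bigl(T_{-1/2}^{n+1}-T_{-3/2}^{n+1}\bigr).$$ Grid functions are complex valued, $\|\cdot\|$ is the norm of $\ell^2(\{j\le -1\})$. Then the scheme is stable for all $\beta,d>0$, namely: 1. (Solvability) For every $T^n\in\ell^2$ there is exactly one $T^{n+1}\in\ell^2$ satisfying the scheme. 2. (Stability in the sense of Gustafsson, Kreiss and Sundström, in mesh units and with growth exponent $0$) There is $K>0$, depending only on $d$ and $\beta$, such that, for all $\eta>0$, all $g^n\in\mathbb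 C$ and all square-summable $F^n=(F^n_{j+1/2})_{j\le -2}$, if $T^n\in\ell^2$ ($n\ge0$), $T^0=0$, solves the scheme with $g^n$ added to the right-hand side of the interface equation and $F^n_{j+1/2}$ added to that of the equation for $j\le -2$, then for every $N\ge0$ $$\tfrac{\eta}{1+\eta}\sum_{n=0}^{N}|e^{-\eta n}T^n_{-1/2}|^2+\Bigl(\tfrac{\eta}{1+\eta}\Bigr)^2\sum_{n=0}^{N}\|e^{-\eta n}T^n\|^2\le K^2\Bigl(\tfrac{\eta}{1+\eta}\sum_{n=0}^{N-1}|e^{-\eta(n+1)}g^n|^2+\sum_{n=0}^{N-1}\|e^{-\eta(n+1)}F^n\|^2\Bigr).$$ 3. (Stability in the initial data) Every solution of the scheme in $\ell^2$ satisfies $\|T^n\|\le\|T^0\|$ for all $n$. 4. (Normal modes) If $A\in\mathbb C$ and $\varphi\neq0$ is a bounded grid function such that $T^n=A^n\varphi$ solves the scheme, then $|A|<1$; that is, there is no nontrivial eigensolution with $|A|\ge 1$. 5. (Explicit modes) For nonzero $A,\kappa\in\mathbb C$, $T^n_{j+1/2}=A^n\kappa^j$ solves the scheme if and only if $\beta\ne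 d$, $\beta-d+\beta^2\neq 0$, $$A=\frac{\beta-d}{\beta-d+\beta^2},\qquad \kappa^{-1}=\frac{d}{d-\beta}.$$ In particular every such mode that is admissible, i.e. $|\kappa^{-1}|\le 1$, has $|A|\le 1$. -/

import Mathlib

/-- Square-summable complex grid functions on the half-line.  The index `m : ℕ` stands for the cell
`j = -1 - m`, whose centre is at `z = (j + 1/2) Δz`; so `m = 0` is the interface cell `-1/2`, and
`m → ∞` is the far field `z → -∞`. -/
abbrev HalfLineL2 : Type := lp (fun _ : ℕ => ℂ) 2

namespace OneWay

/-- Right-hand side of one backward Euler step with implicit interfacial flux, at the new time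
level `v`, where `d` is the diffusive Courant number and `β` the bulk Courant number:
`-β T_{-1/2} - d (T_{-1/2} - T_{-3/2})` in the interface cell, and
`d (T_{j+3/2} - 2 T_{j+1/2} + T_{j-1/2})` in the cells `j < -1`. -/
def rhs (d β : ℝ) (v : ℕ → ℂ) : ℕ → ℂ
  | 0 => -(β : ℂ) * v 0 - (d : ℂ) * (v 0 - v 1)
  | m + 1 => (d : ℂ) * (v m - 2 * v (m + 1) + v (m + 2))

/-- `v = T^{n+1}` is obtained from `u = T^n` by one step of the scheme. -/
def IsStep (d β : ℝ) (u v : ℕ → ℂ) : Prop :=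
  ∀ m, v m - u m = rhs d β v m

/-- `T n m = T^n_{-1-m+1/2}` is a solution of the scheme. -/
def IsSolution (d β : ℝ) (T : ℕ → ℕ → ℂ) : Prop :=
  ∀ n, IsStep d β (T n) (T (n + 1))

/-- `T` is a solution of the scheme with boundary data `g` in the equation of the interface cell
and a source term in the interior equations (`F n m` is the source in cell `m + 1`). -/
def IsForcedSolution (d β : ℝ) (g : ℕ → ℂ) (F T : ℕ → ℕ → ℂ) : Prop :=
  ∀ n, T (n + 1) 0 - T n 0 = rhs d β (T (n + 1)) 0 + g n ∧
    ∀ m, T (n + 1) (m + 1) - T n (m + 1) = rhs d β (T (n + 1)) (m + 1) + F n m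

/-- Every step is uniquely solvable in `ℓ²`. -/
def IsSolvable (d β : ℝ) : Prop :=
  ∀ u : HalfLineL2, ∃! v : HalfLineL2, IsStep d β u v

/-- Stability in the sense of Gustafsson, Kreiss and Sundström, in mesh units (`Δt = Δz = 1`,
`η = α Δt`) and with growth exponent `α₀ = 0`: solutions with zero initial data obey
the weighted estimate, with one constant `K` for all weights `η > 0`, all data and all times. -/
def IsGKSStable (d β : ℝ) : Prop :=
  ∃ K : ℝ, 0 < K ∧ ∀ η : ℝ, 0 < η →
    ∀ (g : ℕ → ℂ) (F T : ℕ → HalfLineL2),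
      IsForcedSolution d β g (fun n => F n) (fun n => T n) → T 0 = 0 → ∀ N : ℕ,
        η / (1 + η) * ∑ n ∈ Finset.range (N + 1), ‖Real.exp (-η * n) * T n 0‖ ^ 2
          + (η / (1 + η)) ^ 2 *
            ∑ n ∈ Finset.range (N + 1), (Real.exp (-η * n) * ‖T n‖) ^ 2
        ≤ K ^ 2 *
          (η / (1 + η) * ∑ n ∈ Finset.range N, ‖Real.exp (-η * (n + 1)) * g n‖ ^ 2
            + ∑ n ∈ Finset.range N, (Real.exp (-η * (n + 1)) * ‖F n‖) ^ 2)

/-- Stability with respect to the initial data, without any growth. -/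
def IsL2Stable (d β : ℝ) : Prop :=
  ∀ T : ℕ → HalfLineL2, IsSolution d β (fun n => T n) → ∀ n, ‖T n‖ ≤ ‖T 0‖

/-- `A^n φ` is a nontrivial eigensolution (normal mode): it solves the scheme, and `φ` is
bounded in the far field. -/
def IsEigensolution (d β : ℝ) (A : ℂ) (φ : ℕ → ℂ) : Prop :=
  φ ≠ 0 ∧ (∃ C : ℝ, ∀ m, ‖φ m‖ ≤ C) ∧ IsSolution d β (fun n m => A ^ n * φ m)

/-- The exponential mode `T^n_{j+1/2} = A^n κ^j`, with `j = -1 - m`. -/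
noncomputable def expMode (A κ : ℂ) : ℕ → ℕ → ℂ :=
  fun n m => A ^ n * κ ^ (-1 - (m : ℤ))

end OneWay

open Finset

namespace OneWay

/-! ### The spatial operator on `ℓ²` and its energy identity. -/

section Operators

/-! With `S` the left shift, one step reads `v + L v = u`, where `L = d D†D + β P`, `D = S - 1` and
`P = 1 - S†S` projects onto the interface cell. Hence `Re ⟨v, L v⟩ = d ‖D v‖² + β |v 0|² ≥ 0`
(`re_inner_dissipation`). So `1 + L` is coercive, hence invertible, and pairing a step with `v`
gives the energy inequality `forced_energy`: it yields contraction in `ℓ²`, and the weighted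
estimate after summation, the interface term `β |v 0|²` absorbing `g`. Normal modes are only
bounded, so there the identity is used on finite sections; boundedness forces the outer boundary
term to vanish in the limit (`eq_zero_of_rhs_eigen`). -/

lemma hasSum_norm_sq (v : HalfLineL2) : HasSum (fun m => ‖v m‖ ^ 2) (‖v‖ ^ 2) := by
  have h := lp.hasSum_norm (p := 2) (by norm_num) v
  simpa using h

lemma memℓp_shift (v : HalfLineL2) : Memℓp (fun m => v (m + 1)) 2 := by
  apply memℓp_gen
  simpa using (summable_nat_add_iff 1).2 (hasSum_norm_sq v).summable

/-- The left shift `v ↦ (v 1, v 2, …)` as a linear map. -/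
noncomputable def shiftₗ : HalfLineL2 →ₗ[ℂ] HalfLineL2 where
  toFun v := ⟨fun m => v (m + 1), memℓp_shift v⟩
  map_add' _ _ := rfl
  map_smul' _ _ := rfl

lemma norm_sq_shiftₗ (v : HalfLineL2) : ‖shiftₗ v‖ ^ 2 = ‖v‖ ^ 2 - ‖v 0‖ ^ 2 := by
  refine (hasSum_norm_sq (shiftₗ v)).unique ?_
  have h := (hasSum_nat_add_iff' 1).2 (hasSum_norm_sq v)
  rwa [sum_range_one] at h

lemma norm_shiftₗ_le (v : HalfLineL2) : ‖shiftₗ v‖ ≤ ‖v‖ :=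
  abs_le_of_sq_le_sq' (by rw [norm_sq_shiftₗ]; nlinarith [sq_nonneg ‖v 0‖]) (norm_nonneg v) |>.2

/-- The left shift `v ↦ (v 1, v 2, …)` as a bounded operator. -/
noncomputable def shift : HalfLineL2 →L[ℂ] HalfLineL2 :=
  shiftₗ.mkContinuous 1 fun v => (norm_shiftₗ_le v).trans_eq (one_mul _).symm

@[simp] lemma shift_apply (v : HalfLineL2) (m : ℕ) : shift v m = v (m + 1) := rfl

lemma norm_sq_shift (v : HalfLineL2) : ‖shift v‖ ^ 2 = ‖v‖ ^ 2 - ‖v 0‖ ^ 2 := norm_sq_shiftₗ v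

lemma norm_shift_le (v : HalfLineL2) : ‖shift v‖ ≤ ‖v‖ := norm_shiftₗ_le v

lemma adjoint_shift_apply (v : HalfLineL2) (m : ℕ) :
    shift.adjoint v m = inner ℂ (shift (lp.single 2 m 1)) v := by
  rw [← ContinuousLinearMap.adjoint_inner_right, lp.inner_single_left]
  simp

@[simp] lemma adjoint_shift_zero (v : HalfLineL2) : shift.adjoint v 0 = 0 := by
  have h : shift (lp.single 2 0 1) = 0 := by
    ext m
    simp
  rw [adjoint_shift_apply, h, inner_zero_left]

@[simp] lemma adjoint_shift_succ (v : HalfLineL2) (m : ℕ) : shift.adjoint v (m + 1) = v m := by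
  have h : shift (lp.single 2 (m + 1) 1) = lp.single 2 m 1 := by
    ext k
    simp [Pi.single_apply]
  rw [adjoint_shift_apply, h, lp.inner_single_left]
  simp

/-- The spatial operator of the scheme: `d D†D + β P`, with `D` the forward difference and `P` the
projection onto the interface cell. -/
noncomputable def dissipation (d β : ℝ) : HalfLineL2 →L[ℂ] HalfLineL2 :=
  (d : ℂ) • ((shift.adjoint - 1) ∘L (shift - 1)) + (β : ℂ) • (1 - shift.adjoint ∘L shift)

lemma dissipation_eq (d β : ℝ) (v : HalfLineL2) :
    dissipation d β v = (d : ℂ) • (shift.adjoint (shift v - v) - (shift v - v))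
      + (β : ℂ) • (v - shift.adjoint (shift v)) := rfl

lemma dissipation_apply (d β : ℝ) (v : HalfLineL2) (m : ℕ) :
    dissipation d β v m = -rhs d β v m := by
  rw [dissipation_eq]
  rcases m with _ | m <;> 
    simp only [rhs, map_sub, lp.coeFn_add, lp.coeFn_sub, lp.coeFn_smul, Pi.add_apply, Pi.sub_apply,
      Pi.smul_apply, smul_eq_mul, shift_apply, adjoint_shift_zero, adjoint_shift_succ] <;> ring

lemma re_inner_dissipation (d β : ℝ) (v : HalfLineL2) :
    (inner ℂ v (dissipation d β v)).re = d * ‖shift v - v‖ ^ 2 + β * ‖v 0‖ ^ 2 := by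
  have h : inner ℂ v (dissipation d β v)
      = (d : ℂ) * inner ℂ (shift v - v) (shift v - v)
        + (β : ℂ) * (inner ℂ v v - inner ℂ (shift v) (shift v)) := by
    simp only [dissipation_eq, inner_add_right, inner_smul_right, inner_sub_right,
      ContinuousLinearMap.adjoint_inner_right, inner_sub_left]
    ring
  rw [h]
  simp only [inner_self_eq_norm_sq_to_K]
  have e : (‖v 0‖ : ℝ) ^ 2 = ‖v‖ ^ 2 - ‖shift v‖ ^ 2 := by rw [norm_sq_shift]; ring
  rw [e, ← Complex.ofReal_re (d * ‖shift v - v‖ ^ 2 + β * (‖v‖ ^ 2 - ‖shift v‖ ^ 2))]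
  push_cast
  rfl

lemma isStep_iff (d β : ℝ) (u v : HalfLineL2) :
    IsStep d β u v ↔ v + dissipation d β v = u := by
  constructor
  · intro h
    ext m
    have := h m
    simp only [lp.coeFn_add, Pi.add_apply, dissipation_apply]
    linear_combination this
  · rintro rfl m
    simp [dissipation_apply]

end Operators

/-! ### Solvability and energy estimates. -/

lemma isSolvable {d β : ℝ} (hd : 0 < d) (hβ : 0 < β) : IsSolvable d β := by
  have hu : IsUnit (1 + dissipation d β) := by
    refine ContinuousLinearMap.isUnit_of_forall_le_norm_inner_map _ (c := 1) one_pos fun x => ?_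
    rw [norm_inner_symm]
    refine le_trans ?_ (Complex.re_le_norm _)
    rw [add_apply, inner_add_right, Complex.add_re, re_inner_dissipation, one_apply_eq_self]
    have : (inner ℂ x x).re = ‖x‖ ^ 2 := inner_self_eq_norm_sq (𝕜 := ℂ) x
    rw [this, NNReal.coe_one, mul_one]
    have : 0 ≤ d * ‖shift x - x‖ ^ 2 + β * ‖x 0‖ ^ 2 := by positivity
    linarith
  intro u
  simp only [isStep_iff]
  exact (ContinuousLinearMap.isUnit_iff_bijective.1 hu).existsUnique u

/-- Pair the step with `v`. The interior source enters as `S†F`, so it meets `S v`, of norm at most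
`‖v‖`. -/
lemma forced_energy {d β : ℝ} (hd : 0 < d) {u v F : HalfLineL2} {g : ℂ}
    (h0 : v 0 - u 0 = rhs d β v 0 + g)
    (h : ∀ m, v (m + 1) - u (m + 1) = rhs d β v (m + 1) + F m) :
    ‖v‖ ^ 2 + 2 * β * ‖v 0‖ ^ 2 ≤ ‖u‖ ^ 2 + 2 * (‖v 0‖ * ‖g‖) + 2 * (‖v‖ * ‖F‖) := by
  have e : v + dissipation d β v = u + lp.single 2 0 g + shift.adjoint F := by
    ext m
    rcases m with _ | m
    · simp only [lp.coeFn_add, Pi.add_apply, dissipation_apply, lp.single_apply_self,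
        adjoint_shift_zero]
      linear_combination h0
    · simp only [lp.coeFn_add, Pi.add_apply, dissipation_apply, adjoint_shift_succ,
        lp.single_apply_ne (E := fun _ : ℕ => ℂ) 2 0 g m.succ_ne_zero]
      linear_combination h m
  have e' := congrArg (fun w => (inner ℂ v w).re) e
  simp only [inner_add_right, Complex.add_re, re_inner_dissipation,
    ContinuousLinearMap.adjoint_inner_right, lp.inner_single_right] at e'
  have hv : (inner ℂ v v).re = ‖v‖ ^ 2 := inner_self_eq_norm_sq (𝕜 := ℂ) v
  have hu : (inner ℂ v u).re ≤ ‖v‖ * ‖u‖ := re_inner_le_norm (𝕜 := ℂ) v u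
  have hg : (inner ℂ (v 0) g).re ≤ ‖v 0‖ * ‖g‖ := re_inner_le_norm (𝕜 := ℂ) (v 0) g
  have hF : (inner ℂ (shift v) F).re ≤ ‖v‖ * ‖F‖ :=
    (re_inner_le_norm (𝕜 := ℂ) (shift v) F).trans
      (mul_le_mul_of_nonneg_right (norm_shift_le v) (norm_nonneg F))
  have hD : 0 ≤ d * ‖shift v - v‖ ^ 2 := by positivity
  nlinarith [sq_nonneg (‖v‖ - ‖u‖)]

lemma isL2Stable {d β : ℝ} (hd : 0 < d) (hβ : 0 < β) : IsL2Stable d β := by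
  intro T hT n
  induction n with
  | zero => exact le_rfl
  | succ n ih =>
    refine le_trans ?_ ih
    have h := forced_energy (β := β) (F := 0) (g := 0) hd (by simpa using hT n 0)
      (fun m => by simpa using hT n (m + 1))
    simp only [norm_zero, mul_zero, add_zero] at h
    have : 0 ≤ 2 * β * ‖T (n + 1) 0‖ ^ 2 := by positivity
    exact abs_le_of_sq_le_sq' (by linarith) (norm_nonneg _) |>.2

/-- Discrete Gronwall-type summation of a damped energy inequality. -/
lemma sum_le_of_damped {θ β : ℝ} {a b R : ℕ → ℝ} (ha : a 0 = 0) (hb : b 0 = 0)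
    (h : ∀ n, (1 - θ / 2) * a (n + 1) + β * b (n + 1) ≤ (1 - θ) * a n + R n) (N : ℕ) :
    θ / 2 * ∑ n ∈ range (N + 1), a n + β * ∑ n ∈ range (N + 1), b n + (1 - θ) * a N
      ≤ ∑ n ∈ range N, R n := by
  induction N with
  | zero => simp [ha, hb]
  | succ N ih =>
    rw [sum_range_succ _ (N + 1), sum_range_succ b (N + 1), sum_range_succ R]
    linarith [h N]

lemma exp_neg_two_mul_le {η : ℝ} (hη : 0 < η) : Real.exp (-η) ^ 2 ≤ 1 - η / (1 + η) := by
  have h1 : Real.exp (-η) ≤ (1 + η)⁻¹ := by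
    rw [Real.exp_neg]
    exact inv_anti₀ (by linarith) (by linarith [Real.add_one_le_exp η])
  have h2 : 1 - η / (1 + η) = (1 + η)⁻¹ := by field_simp; ring
  have h3 : Real.exp (-η) ≤ 1 := Real.exp_le_one_iff.2 (by linarith)
  rw [h2]
  nlinarith [Real.exp_pos (-η)]

lemma isGKSStable {d β : ℝ} (hd : 0 < d) (hβ : 0 < β) : IsGKSStable d β := by
  -- This number is spent twice, hence `K ^ 2`: once to restore the coefficients `1/2` and `β` on
  -- the left to at least 1, once to dominate `β⁻¹` and `2` on the right.
  refine ⟨2 + β⁻¹, by positivity, fun η hη g F T hT hT0 N => ?_⟩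
  obtain ⟨θ, hθ⟩ : ∃ θ, θ = η / (1 + η) := ⟨_, rfl⟩
  have hθ0 : 0 < θ := by rw [hθ]; positivity
  have hexp := exp_neg_two_mul_le hη
  rw [← hθ] at hexp ⊢
  have key := sum_le_of_damped (θ := θ) (β := β)
    (a := fun n => (Real.exp (-η * n) * ‖T n‖) ^ 2)
    (b := fun n => ‖Real.exp (-η * n) * T n 0‖ ^ 2)
    -- Young's inequality: `g` costs half of the damping `2 β |v 0|²`, `F` costs `θ / 2` of the
    -- decay `θ` supplied by the weight.
    (R := fun n => β⁻¹ * ‖Real.exp (-η * (n + 1)) * g n‖ ^ 2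
      + 2 / θ * (Real.exp (-η * (n + 1)) * ‖F n‖) ^ 2)
    (by simp [hT0]) (by simp [hT0]) (fun n => by
      have h := forced_energy hd (hT n).1 (hT n).2
      have hs : Real.exp (-η * (n + 1)) = Real.exp (-η) * Real.exp (-η * n) := by
        rw [← Real.exp_add]; ring_nf
      simp only [norm_mul, Complex.norm_real, Real.norm_eq_abs, Real.abs_exp, Nat.cast_add,
        Nat.cast_one, mul_pow]
      have hw : Real.exp (-η * (n + 1)) ^ 2 * ‖T n‖ ^ 2
          ≤ (1 - θ) * (Real.exp (-η * n) ^ 2 * ‖T n‖ ^ 2) := by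
        rw [hs, mul_pow, mul_assoc]
        exact mul_le_mul_of_nonneg_right hexp (by positivity)
      have hg : 2 * (‖T (n + 1) 0‖ * ‖g n‖) ≤ β * ‖T (n + 1) 0‖ ^ 2 + β⁻¹ * ‖g n‖ ^ 2 := by
        have := mul_nonneg (inv_pos.2 hβ).le (sq_nonneg (β * ‖T (n + 1) 0‖ - ‖g n‖))
        have e : β⁻¹ * (β * ‖T (n + 1) 0‖ - ‖g n‖) ^ 2
          = β * ‖T (n + 1) 0‖ ^ 2 + β⁻¹ * ‖g n‖ ^ 2 - 2 * (‖T (n + 1) 0‖ * ‖g n‖) := by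
          field_simp; ring
        linarith
      have hF : 2 * (‖T (n + 1)‖ * ‖F n‖) ≤ θ / 2 * ‖T (n + 1)‖ ^ 2 + 2 / θ * ‖F n‖ ^ 2 := by
        have := mul_nonneg (div_pos two_pos hθ0).le
          (sq_nonneg (θ / 2 * ‖T (n + 1)‖ - ‖F n‖))
        have e : 2 / θ * (θ / 2 * ‖T (n + 1)‖ - ‖F n‖) ^ 2
          = θ / 2 * ‖T (n + 1)‖ ^ 2 + 2 / θ * ‖F n‖ ^ 2 - 2 * (‖T (n + 1)‖ * ‖F n‖) := by
          field_simp; ring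
        linarith
      have h' : (1 - θ / 2) * ‖T (n + 1)‖ ^ 2 + β * ‖T (n + 1) 0‖ ^ 2
          ≤ ‖T n‖ ^ 2 + β⁻¹ * ‖g n‖ ^ 2 + 2 / θ * ‖F n‖ ^ 2 := by linarith
      have := mul_le_mul_of_nonneg_left h' (sq_nonneg (Real.exp (-η * (n + 1))))
      linarith) N
  simp only [sum_add_distrib, ← mul_sum] at key
  have hlast : 0 ≤ (1 - θ) * (Real.exp (-η * N) * ‖T N‖) ^ 2 :=
    mul_nonneg ((sq_nonneg _).trans hexp) (sq_nonneg _)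
  have hA : 0 ≤ ∑ n ∈ range (N + 1), (Real.exp (-η * n) * ‖T n‖) ^ 2 :=
    sum_nonneg fun _ _ => sq_nonneg _
  have hB : 0 ≤ ∑ n ∈ range (N + 1), ‖Real.exp (-η * n) * T n 0‖ ^ 2 :=
    sum_nonneg fun _ _ => sq_nonneg _
  have hG : 0 ≤ ∑ n ∈ range N, ‖Real.exp (-η * (n + 1)) * g n‖ ^ 2 :=
    sum_nonneg fun _ _ => sq_nonneg _
  have hF : 0 ≤ ∑ n ∈ range N, (Real.exp (-η * (n + 1)) * ‖F n‖) ^ 2 :=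
    sum_nonneg fun _ _ => sq_nonneg _
  generalize ∑ n ∈ range (N + 1), (Real.exp (-η * n) * ‖T n‖) ^ 2 = A at *
  generalize ∑ n ∈ range (N + 1), ‖Real.exp (-η * n) * T n 0‖ ^ 2 = B at *
  generalize ∑ n ∈ range N, ‖Real.exp (-η * (n + 1)) * g n‖ ^ 2 = G at *
  generalize ∑ n ∈ range N, (Real.exp (-η * (n + 1)) * ‖F n‖) ^ 2 = Φ at *
  have k1 : θ ^ 2 * A / 2 + β * (θ * B) ≤ β⁻¹ * (θ * G) + 2 * Φ := by
    have := mul_le_mul_of_nonneg_left ((le_add_of_nonneg_right hlast).trans key) hθ0.le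
    have e : θ * (β⁻¹ * G + 2 / θ * Φ) = β⁻¹ * (θ * G) + 2 * Φ := by field_simp
    rw [e] at this
    linarith
  have hγ : 0 < β⁻¹ := inv_pos.2 hβ
  have hββ : β⁻¹ * β = 1 := inv_mul_cancel₀ hβ.ne'
  have hX : 0 ≤ θ ^ 2 * A := by positivity
  have hY : 0 ≤ θ * B := by positivity
  have hZ : 0 ≤ θ * G := by positivity
  calc θ * B + θ ^ 2 * A
      ≤ (2 + β⁻¹) * (θ ^ 2 * A / 2 + β * (θ * B)) := by
        have : (2 + β⁻¹) * (θ ^ 2 * A / 2 + β * (θ * B))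
          = θ * B * (β⁻¹ * β) + θ ^ 2 * A + β⁻¹ * (θ ^ 2 * A) / 2 + 2 * β * (θ * B) := by ring
        rw [this, hββ]
        have := mul_nonneg hγ.le hX
        have := mul_nonneg hβ.le hY
        linarith
    _ ≤ (2 + β⁻¹) * (β⁻¹ * (θ * G) + 2 * Φ) := mul_le_mul_of_nonneg_left k1 (by positivity)
    _ ≤ (2 + β⁻¹) * ((2 + β⁻¹) * (θ * G + Φ)) := by
        refine mul_le_mul_of_nonneg_left ?_ (by positivity)
        have := mul_nonneg hγ.le hF
        linarith
    _ = (2 + β⁻¹) ^ 2 * (θ * G + Φ) := by ring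

/-! ### Bounded normal modes. -/

section NormalModes

/-- Summation by parts on a finite section of the half-line. -/
lemma sum_inner_rhs (d β : ℝ) (φ : ℕ → ℂ) (M : ℕ) :
    ∑ m ∈ range (M + 1), (starRingEnd ℂ (φ m) * rhs d β φ m).re
      = -β * ‖φ 0‖ ^ 2 - d * ∑ m ∈ range M, ‖φ (m + 1) - φ m‖ ^ 2
        + d * (starRingEnd ℂ (φ M) * (φ (M + 1) - φ M)).re := by
  induction M with
  | zero =>
    simp [rhs, ← Complex.normSq_eq_norm_sq, Complex.normSq_apply]
    ring
  | succ M ih =>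
    rw [sum_range_succ, ih, sum_range_succ]
    simp [rhs, ← Complex.normSq_eq_norm_sq, Complex.normSq_apply]
    ring

/-- Since `Re μ ≥ 0`, summation by parts bounds the dissipation on a section by its outer boundary
term. -/
lemma eq_zero_of_rhs_eigen {d β : ℝ} (hd : 0 < d) (hβ : 0 < β) {φ : ℕ → ℂ} {C : ℝ}
    (hC : ∀ m, ‖φ m‖ ≤ C) {μ : ℂ} (hμ : 0 ≤ μ.re) (h : ∀ m, rhs d β φ m = μ * φ m) : φ = 0 := by
  have hC0 : 0 ≤ C := (norm_nonneg _).trans (hC 0)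
  have key : ∀ M, β * ‖φ 0‖ ^ 2 + d * ∑ m ∈ range M, ‖φ (m + 1) - φ m‖ ^ 2
      ≤ d * (C * ‖φ (M + 1) - φ M‖) := fun M => by
    have hs := sum_inner_rhs d β φ M
    have h0 : 0 ≤ ∑ m ∈ range (M + 1), (starRingEnd ℂ (φ m) * rhs d β φ m).re := by
      refine sum_nonneg fun m _ => ?_
      have : starRingEnd ℂ (φ m) * rhs d β φ m = μ * (Complex.normSq (φ m) : ℂ) := by
        rw [h, Complex.normSq_eq_conj_mul_self]; ring
      rw [this, Complex.re_mul_ofReal]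
      exact mul_nonneg hμ (Complex.normSq_nonneg _)
    have h1 : (starRingEnd ℂ (φ M) * (φ (M + 1) - φ M)).re ≤ C * ‖φ (M + 1) - φ M‖ := by
      refine (Complex.re_le_norm _).trans ?_
      rw [norm_mul, RCLike.norm_conj]
      exact mul_le_mul_of_nonneg_right (hC M) (norm_nonneg _)
    have := mul_le_mul_of_nonneg_left h1 hd.le
    linarith
  -- The boundary term is at most `2 d C²`, so the differences are square summable and that term in
  -- fact tends to 0. This kills `φ 0`, and the recurrence then kills `φ`.
  have hsum : Summable fun m => ‖φ (m + 1) - φ m‖ ^ 2 := by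
    refine summable_of_sum_range_le (c := C * (C + C)) (fun _ => sq_nonneg _) fun M => ?_
    have h1 : ‖φ (M + 1) - φ M‖ ≤ C + C :=
      (norm_sub_le _ _).trans (add_le_add (hC _) (hC _))
    have h2 := mul_le_mul_of_nonneg_left h1 hC0
    refine le_of_mul_le_mul_left ?_ hd
    have h3 := mul_le_mul_of_nonneg_left h2 hd.le
    have : 0 ≤ β * ‖φ 0‖ ^ 2 := by positivity
    linarith [key M]
  have hlim : Filter.Tendsto (fun M => d * (C * ‖φ (M + 1) - φ M‖)) Filter.atTop (nhds 0) := by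
    have h1 := hsum.tendsto_atTop_zero.sqrt
    simp only [Real.sqrt_sq (norm_nonneg _), Real.sqrt_zero] at h1
    simpa using (h1.const_mul C).const_mul d
  have hle : β * ‖φ 0‖ ^ 2 ≤ 0 := ge_of_tendsto' hlim fun M => by
    have : 0 ≤ d * ∑ m ∈ range M, ‖φ (m + 1) - φ m‖ ^ 2 :=
      mul_nonneg hd.le (sum_nonneg fun _ _ => sq_nonneg _)
    linarith [key M]
  have hφ0 : φ 0 = 0 := by
    have : ‖φ 0‖ ^ 2 ≤ 0 := by nlinarith
    simpa using le_antisymm this (sq_nonneg _)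
  have hdC : (d : ℂ) ≠ 0 := by exact_mod_cast hd.ne'
  have hφ1 : φ 1 = 0 := by
    have := h 0
    simp only [rhs, hφ0] at this
    exact (mul_eq_zero.1 (show (d : ℂ) * φ 1 = 0 by linear_combination this)).resolve_left hdC
  have hall : ∀ m, φ m = 0 ∧ φ (m + 1) = 0 := fun m => by
    induction m with
    | zero => exact ⟨hφ0, hφ1⟩
    | succ m ih =>
      refine ⟨ih.2, ?_⟩
      have := h (m + 1)
      simp only [rhs, ih.1, ih.2] at this
      exact (mul_eq_zero.1
        (show (d : ℂ) * φ (m + 2) = 0 by linear_combination this)).resolve_left hdC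
  exact funext fun m => (hall m).1

lemma rhs_smul (d β : ℝ) (c : ℂ) (v : ℕ → ℂ) (m : ℕ) :
    rhs d β (fun k => c * v k) m = c * rhs d β v m := by
  cases m <;> simp only [rhs] <;> ring

lemma isSolution_pow_iff (d β : ℝ) {A : ℂ} (φ : ℕ → ℂ) :
    IsSolution d β (fun n m => A ^ n * φ m) ↔ ∀ m, (A - 1) * φ m = A * rhs d β φ m := by
  simp only [IsSolution, IsStep, rhs_smul]
  constructor
  · intro h m
    have := h 0 m
    simp only [zero_add, pow_one, pow_zero, one_mul] at this
    linear_combination this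
  · intro h n m
    rw [pow_succ]
    linear_combination A ^ n * h m

lemma norm_lt_one_of_isEigensolution {d β : ℝ} (hd : 0 < d) (hβ : 0 < β) {A : ℂ} {φ : ℕ → ℂ}
    (h : IsEigensolution d β A φ) : ‖A‖ < 1 := by
  obtain ⟨hφ, ⟨C, hC⟩, hsol⟩ := h
  by_contra! hA
  have hA0 : A ≠ 0 := by
    rintro rfl
    simp at hA
    linarith
  rw [isSolution_pow_iff] at hsol
  -- Dividing `(A - 1) φ = A rhs φ` by `A` gives `μ = 1 - A⁻¹`, whose real part is nonnegative when
  -- `‖A‖ ≥ 1`.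
  refine hφ (eq_zero_of_rhs_eigen hd hβ hC (μ := 1 - A⁻¹) ?_ fun m => ?_)
  · have : A⁻¹.re ≤ 1 := (Complex.re_le_norm _).trans <| by
      rw [norm_inv]; exact inv_le_one_of_one_le₀ hA
    simpa using this
  · have := hsol m
    field_simp
    linear_combination -this

end NormalModes

/-! ### Exponential modes. -/

section ExplicitModes

lemma expMode_eq (A κ : ℂ) :
    expMode A κ = fun n m => A ^ n * κ⁻¹ ^ (m + 1) := by
  funext n m
  simp only [expMode]
  congr 1
  rw [inv_pow, ← zpow_natCast, ← zpow_neg]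
  congr 1
  push_cast
  ring

/-- All interior equations are multiples of a single one by powers of `q`, so cells 0 and 1 suffice.
-/
lemma isSolution_geometric_iff (d β : ℝ) {A q : ℂ} (hq : q ≠ 0) :
    IsSolution d β (fun n m => A ^ n * q ^ (m + 1)) ↔
      A - 1 = A * (-β - d * (1 - q)) ∧ (A - 1) * q = A * (d * (1 - 2 * q + q ^ 2)) := by
  rw [isSolution_pow_iff d β fun m => q ^ (m + 1)]
  constructor
  · intro h
    have h0 := h 0
    have h1 := h 1
    simp only [rhs] at h0 h1
    constructor <;> apply mul_left_cancel₀ hq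
    · linear_combination h0
    · linear_combination h1
  · rintro ⟨h0, h1⟩ m
    rcases m with _ | m <;> simp only [rhs]
    · linear_combination q * h0
    · linear_combination q ^ (m + 1) * h1

lemma isSolution_expMode_iff {d β : ℝ} (hd : 0 < d) {A κ : ℂ} (hA : A ≠ 0) (hκ : κ ≠ 0) :
    IsSolution d β (expMode A κ) ↔
      β - d ≠ 0 ∧ β - d + β ^ 2 ≠ 0 ∧
        A = (((β - d) / (β - d + β ^ 2) : ℝ) : ℂ) ∧ κ⁻¹ = ((d / (d - β) : ℝ) : ℂ) := by
  rw [expMode_eq, isSolution_geometric_iff d β (inv_ne_zero hκ)]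
  generalize κ⁻¹ = q
  have hdC : (d : ℂ) ≠ 0 := by exact_mod_cast hd.ne'
  constructor
  · rintro ⟨h0, h1⟩
    -- Subtracting `q` times the interface equation from the interior one cancels the quadratic term
    -- and leaves a multiple of `A`.
    have hq : (d - β) * q = d :=
      mul_left_cancel₀ hA (by linear_combination h1 - q * h0)
    have hbd : (β : ℂ) - d ≠ 0 := fun h => hdC (by linear_combination -hq - q * h)
    have hAeq : A * (β - d + β ^ 2) = β - d := by
      linear_combination (β - d : ℂ) * h0 - A * d * hq
    have hden : (β : ℂ) - d + β ^ 2 ≠ 0 := fun h => hbd (by rw [← hAeq, h, mul_zero])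
    refine ⟨by exact_mod_cast hbd, by exact_mod_cast hden, ?_, ?_⟩
    · push_cast
      rw [eq_div_iff hden, hAeq]
    · push_cast
      rw [eq_div_iff (by rw [← neg_sub]; exact neg_ne_zero.2 hbd), mul_comm, hq]
  · rintro ⟨h1, h2, rfl, rfl⟩
    have hbd : (β : ℂ) - d ≠ 0 := by exact_mod_cast h1
    have hdb : (d : ℂ) - β ≠ 0 := by rw [← neg_sub]; exact neg_ne_zero.2 hbd
    have hden : (β : ℂ) - d + β ^ 2 ≠ 0 := by exact_mod_cast h2
    push_cast
    constructor <;> field_simp <;> ring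

lemma norm_le_one_of_expMode {d β : ℝ} (hd : 0 < d) (hβ : 0 < β) {A κ : ℂ} (hκ : 1 ≤ ‖κ‖)
    (h : IsSolution d β (expMode A κ)) : ‖A‖ ≤ 1 := by
  have hκ0 : κ ≠ 0 := norm_pos_iff.1 (one_pos.trans_le hκ)
  rw [expMode_eq] at h
  refine (norm_lt_one_of_isEigensolution hd hβ (φ := fun m => κ⁻¹ ^ (m + 1))
    ⟨fun h0 => ?_, ⟨1, fun m => ?_⟩, h⟩).le
  · simpa [hκ0] using congrFun h0 0
  · rw [norm_pow, norm_inv]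
    exact pow_le_one₀ (by positivity) (inv_le_one_of_one_le₀ hκ)

end ExplicitModes

end OneWay

theorem theorem2 (d β : ℝ) (hd : 0 < d) (hβ : 0 < β) :
    OneWay.IsSolvable d β ∧
    OneWay.IsGKSStable d β ∧
    OneWay.IsL2Stable d β ∧
    (∀ (A : ℂ) (φ : ℕ → ℂ), OneWay.IsEigensolution d β A φ → ‖A‖ < 1) ∧
    (∀ A κ : ℂ, A ≠ 0 → κ ≠ 0 →
      (OneWay.IsSolution d β (OneWay.expMode A κ) ↔
        β - d ≠ 0 ∧ β - d + β ^ 2 ≠ 0 ∧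
          A = (((β - d) / (β - d + β ^ 2) : ℝ) : ℂ) ∧ κ⁻¹ = ((d / (d - β) : ℝ) : ℂ))) ∧
    (∀ A κ : ℂ, A ≠ 0 → 1 ≤ ‖κ‖ → OneWay.IsSolution d β (OneWay.expMode A κ) → ‖A‖ ≤ 1) :=
  ⟨OneWay.isSolvable hd hβ, OneWay.isGKSStable hd hβ, OneWay.isL2Stable hd hβ,
    fun _ _ h => OneWay.norm_lt_one_of_isEigensolution hd hβ h,
    fun _ _ hA hκ => OneWay.isSolution_expMode_iff hd hA hκ,
    fun _ _ _ hκ h => OneWay.norm_le_one_of_expMode hd hβ hκ h⟩
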